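/- All systems are finite-dimensional: \(A=\mathbb{C}^a\), \(B=\mathbb{C}^b\), and so on. For a pure state \(\psi=|\psi\rangle\langle\psi|\) of \(AB\) let \(N(\psi)=\operatorname{rank}(\operatorname{Tr}_B\psi)\) be its Schmidt rank. \(\mathrm{LOCC}(A'B'\to AB)\) denotes the set of channels that are implementable by local operations and classical communication in finitely many rounds, where in each round one party performs a local measurement with finitely many outcomes, announces the outcome, and the rest of the protocol may depend on it. For a bipartite density matrix \(\rho\) on \(AB\), the maximal extension of \(N\) is \[ \overline N(\rho)=\inf\{N(\psi):\ \rho=\mathcal E(\psi),\ \mathcal E\in\mathrm{LOCC}(A'B'\to AB),\ \psi \text{ a pure state of } A'B'\}, \] where the infimum runs over all systems \(A',B'\) as well. The Schmidt number of \(\rho\) in the sense of Terhal and Horodecki is the number \(k\) such that (1) every finite pure-state decomposition \(\rho=\sum_i p_i|\psi_i\rangle\langle\psi_i|\), \(p_i\ge 0\), \(\|\psi_i\|=1\), contains at least one state of Schmidt rank at least \(k\), and (2) some such decomposition has all states of Schmidt rank at most \(k\). **Lemma.** Let \(\rho\) be a bipartite density matrix on \(AB\). There is exactly one \(k\in\mathbb{N}\)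 satisfying (1) and (2), namely \[ N(\rho)=\min_{\rho=\sum_i p_i|\psi_i\rangle\langle\psi_i|}\ \max_i\, N(\psi_i), \] and \(\overline N(\rho)=N(\rho)\). Consequently, if \(E\) is any entanglement measure (a real-valued function on the bipartite density matrices of all finite-dimensional systems that does not increase under LOCC channels) with \(E(\psi)=N(\psi)\) for every pure bipartite state \(\psi\), then \(E(\rho)\le N(\rho)\). -/

import Mathlib

open Matrix
open scoped Kronecker ComplexOrder

namespace Bipartite

/-- The matrix algebra of the bipartite system `AB` with `A = ℂ^a` and `B = ℂ^b`. -/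
abbrev Op (a b : ℕ) : Type := Matrix (Fin a × Fin b) (Fin a × Fin b) ℂ

/-- Density matrices of the bipartite system `AB` with `|A| = a` and `|B| = b`. -/
structure State (a b : ℕ) where
  mat : Op a b
  posSemidef : mat.PosSemidef
  trace_eq_one : mat.trace = 1

/-- `ρ` is pure: `ρ = |ψ⟩⟨ψ|` for a unit vector `ψ`. -/
def State.IsPure {a b : ℕ} (ρ : State a b) : Prop :=
  ∃ ψ : Fin a × Fin b → ℂ, star ψ ⬝ᵥ ψ = 1 ∧ ρ.mat = vecMulVec ψ (star ψ)

/-- The set `PURE(AB)` of pure states, as a subset of the density matrices. -/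
def PureState (a b : ℕ) : Type := {ρ : State a b // ρ.IsPure}

/-- The partial trace over the second system. -/
def traceB {a b : ℕ} (X : Op a b) : Matrix (Fin a) (Fin a) ℂ :=
  Matrix.of fun i j => ∑ k, X (i, k) (j, k)

/-- The Schmidt rank `N(ψ)` of a pure state: the rank of its reduced density matrix on `A`. -/
noncomputable def PureState.schmidtRank {a b : ℕ} (ψ : PureState a b) : ℕ :=
  (traceB ψ.1.mat).rank

/-- The map `X ↦ (K ⊗ 1) X (K ⊗ 1)ᴴ`: Alice applies the Kraus operator `K`. -/
noncomputable def aliceKraus {a a' : ℕ} (b : ℕ) (K : Matrix (Fin a') (Fin a) ℂ) :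
    Op a b →ₗ[ℂ] Op a' b where
  toFun X := (K ⊗ₖ (1 : Matrix (Fin b) (Fin b) ℂ)) * X * (K ⊗ₖ (1 : Matrix (Fin b) (Fin b) ℂ))ᴴ
  map_add' X Y := by rw [Matrix.mul_add, Matrix.add_mul]
  map_smul' c X := by rw [Matrix.mul_smul, Matrix.smul_mul, RingHom.id_apply]

/-- The map `X ↦ (1 ⊗ M) X (1 ⊗ M)ᴴ`: Bob applies the Kraus operator `M`. -/
noncomputable def bobKraus (a : ℕ) {b b' : ℕ} (M : Matrix (Fin b') (Fin b) ℂ) :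
    Op a b →ₗ[ℂ] Op a b' where
  toFun X := ((1 : Matrix (Fin a) (Fin a) ℂ) ⊗ₖ M) * X * ((1 : Matrix (Fin a) (Fin a) ℂ) ⊗ₖ M)ᴴ
  map_add' X Y := by rw [Matrix.mul_add, Matrix.add_mul]
  map_smul' c X := by rw [Matrix.mul_smul, Matrix.smul_mul, RingHom.id_apply]

/-- The channels `AB → CD` realised by local operations and (two-way) classical communication
in finitely many rounds. In a round one party performs a local measurement with finitely many
outcomes `j`, given by Kraus operators `K j` with `∑ j, (K j)ᴴ * K j = 1` (the output dimension
may depend on `j`, so that ancillas may be added and systems discarded), and announces `j`;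
the parties then continue with an LOCC protocol that may depend on `j`. Since the continuation
need not use all of `j`, and the final outcome record is discarded by the sum, this covers
arbitrary local instruments, local channels and shared randomness. -/
inductive IsLOCC : {a b c d : ℕ} → (Op a b →ₗ[ℂ] Op c d) → Prop
  | id (a b : ℕ) : IsLOCC (LinearMap.id : Op a b →ₗ[ℂ] Op a b)
  | alice {a b c d n : ℕ} (a' : Fin n → ℕ) (K : (j : Fin n) → Matrix (Fin (a' j)) (Fin a) ℂ)
      (hK : ∑ j, (K j)ᴴ * K j = 1) (Φ : (j : Fin n) → Op (a' j) b →ₗ[ℂ] Op c d)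
      (hΦ : ∀ j, IsLOCC (Φ j)) : IsLOCC (∑ j, Φ j ∘ₗ aliceKraus b (K j))
  | bob {a b c d n : ℕ} (b' : Fin n → ℕ) (M : (j : Fin n) → Matrix (Fin (b' j)) (Fin b) ℂ)
      (hM : ∑ j, (M j)ᴴ * M j = 1) (Φ : (j : Fin n) → Op a (b' j) →ₗ[ℂ] Op c d)
      (hΦ : ∀ j, IsLOCC (Φ j)) : IsLOCC (∑ j, Φ j ∘ₗ bobKraus a (M j))

/-- The state `σ` can be converted into `ρ` by an LOCC channel. -/
def LOCCConvertible {a b c d : ℕ} (σ : State a b) (ρ : State c d) : Prop :=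
  ∃ Φ : Op a b →ₗ[ℂ] Op c d, IsLOCC Φ ∧ ρ.mat = Φ σ.mat

/-- The maximal extension of a function `E₁` on pure bipartite states to mixed bipartite states:
the infimum of `E₁ ψ` over all systems `A', B'` and all pure states `ψ` of `A'B'` that some LOCC
channel converts into `ρ` (and `+∞` if there are none). -/
noncomputable def maximalExtension (E₁ : ⦃a b : ℕ⦄ → PureState a b → ℝ)
    {a b : ℕ} (ρ : State a b) : EReal :=
  sInf {x : EReal | ∃ (a' b' : ℕ) (ψ : PureState a' b'),
    LOCCConvertible ψ.1 ρ ∧ x = (E₁ ψ : EReal)}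

/-- The Schmidt rank as a real-valued function on all pure bipartite states. -/
noncomputable def pureSchmidtRank ⦃a b : ℕ⦄ (ψ : PureState a b) : ℝ := ψ.schmidtRank

/-- A (finite) pure-state decomposition `ρ = ∑ i, p i |ψ i⟩⟨ψ i|` with weights `p i ≥ 0`. -/
structure PureDecomposition {a b : ℕ} (ρ : State a b) where
  n : ℕ
  p : Fin n → ℝ
  p_nonneg : ∀ i, 0 ≤ p i
  ψ : Fin n → PureState a b
  sum_eq : ρ.mat = ∑ i, (p i : ℂ) • (ψ i).1.mat

/-- The largest Schmidt rank among the states of a decomposition. -/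
noncomputable def PureDecomposition.maxSchmidtRank {a b : ℕ} {ρ : State a b}
    (D : PureDecomposition ρ) : ℕ :=
  Finset.univ.sup fun i => (D.ψ i).schmidtRank

/-- `ρ` has Schmidt number `k` in the sense of Terhal and Horodecki: every pure-state
decomposition of `ρ` has a member of Schmidt rank at least `k`, and some pure-state decomposition
has all members of Schmidt rank at most `k`. -/
def HasSchmidtNumber {a b : ℕ} (ρ : State a b) (k : ℕ) : Prop :=
  (∀ D : PureDecomposition ρ, ∃ i, k ≤ (D.ψ i).schmidtRank) ∧
    ∃ D : PureDecomposition ρ, ∀ i, (D.ψ i).schmidtRank ≤ k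

/-- The Schmidt number: the minimum over all pure-state decompositions of the largest Schmidt
rank among the states of the decomposition. -/
noncomputable def schmidtNumber {a b : ℕ} (ρ : State a b) : ℕ :=
  sInf (Set.range fun D : PureDecomposition ρ => D.maxSchmidtRank)

/-- An entanglement measure: a real-valued function of all bipartite states that does not
increase under LOCC channels. -/
def IsEntanglementMeasure (E : ⦃a b : ℕ⦄ → State a b → ℝ) : Prop :=
  ∀ ⦃a b c d : ℕ⦄ (σ : State a b) (ρ : State c d), LOCCConvertible σ ρ → E ρ ≤ E σ

end Bipartite

/-! A pure state is its coefficient matrix `N`, and its Schmidt rank is `N.rank`. A Kraus operator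
of Alice or Bob multiplies `N` on one side, so it cannot raise the rank. Hence LOCC preserves the
cone `rankCone` of mixtures of Schmidt rank at most `k`, and a pure state convertible into `ρ` has
Schmidt rank at least `schmidtNumber ρ`. Conversely, let `k` be the largest Schmidt rank in an
optimal decomposition of `ρ`. The maximally entangled state of rank `k` is turned with certainty
into each member (`exists_isLOCC_maxEntangled`, resting on `exists_schmidt_factorization`); drawing
the member at random yields `ρ`. The infimum is thus attained, and monotonicity of `E` along this
conversion bounds `E ρ`. -/

namespace Bipartite

/-! ### Vectorised pure states -/

/-- The unnormalised pure state `|N⟫⟨⟨N|` of `AB` whose coefficient matrix is `N`. -/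
noncomputable def vecProj {a b : ℕ} (N : Matrix (Fin b) (Fin a) ℂ) : Op a b :=
  vecMulVec (vec N) (star (vec N))

lemma vecProj_zero {a b : ℕ} : vecProj (0 : Matrix (Fin b) (Fin a) ℂ) = 0 := by
  simp [vecProj]

lemma vecProj_smul {a b : ℕ} (c : ℂ) (N : Matrix (Fin b) (Fin a) ℂ) :
    vecProj (c • N) = (c * star c) • vecProj N := by
  simp only [vecProj, vec_smul, star_smul, smul_vecMulVec, vecMulVec_smul, smul_smul,
    mul_comm]

lemma mul_vecProj_mul_conjTranspose {a b c d : ℕ}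
    (T : Matrix (Fin c × Fin d) (Fin a × Fin b) ℂ) (N : Matrix (Fin b) (Fin a) ℂ)
    (N' : Matrix (Fin d) (Fin c) ℂ) (h : T *ᵥ vec N = vec N') :
    T * vecProj N * Tᴴ = vecProj N' := by
  rw [vecProj, mul_vecMulVec, vecMulVec_mul, ← star_mulVec, h, vecProj]

/-- `vec` stacks columns, so Alice's index is the column index: she acts from the right, Bob from
the left. -/
lemma aliceKraus_vecProj {a a' b : ℕ} (K : Matrix (Fin a') (Fin a) ℂ)
    (N : Matrix (Fin b) (Fin a) ℂ) : aliceKraus b K (vecProj N) = vecProj (N * Kᵀ) :=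
  mul_vecProj_mul_conjTranspose _ _ _ (by rw [kronecker_mulVec_vec, Matrix.one_mul])

lemma bobKraus_vecProj {a b b' : ℕ} (M : Matrix (Fin b') (Fin b) ℂ)
    (N : Matrix (Fin b) (Fin a) ℂ) : bobKraus a M (vecProj N) = vecProj (M * N) :=
  mul_vecProj_mul_conjTranspose _ _ _
    (by rw [kronecker_mulVec_vec, transpose_one, Matrix.mul_one])

lemma rank_traceB_vecProj {a b : ℕ} (N : Matrix (Fin b) (Fin a) ℂ) :
    (traceB (vecProj N)).rank = N.rank := by
  have h : traceB (vecProj N) = Nᵀ * Nᵀᴴ := by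
    ext i j
    simp [traceB, vecProj, vecMulVec_apply, Matrix.mul_apply, vec]
  rw [h, rank_self_mul_conjTranspose, rank_transpose]

/-- The normalised pure state with coefficient matrix `N`. -/
noncomputable def PureState.ofMatrix {a b : ℕ} (N : Matrix (Fin b) (Fin a) ℂ)
    (hN : star (vec N) ⬝ᵥ vec N = 1) : PureState a b :=
  ⟨⟨vecProj N, posSemidef_vecMulVec_self_star _, by
    rw [vecProj, trace_vecMulVec, dotProduct_comm, hN]⟩, vec N, hN, rfl⟩

lemma PureState.schmidtRank_ofMatrix {a b : ℕ} (N : Matrix (Fin b) (Fin a) ℂ)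
    (hN : star (vec N) ⬝ᵥ vec N = 1) : (PureState.ofMatrix N hN).schmidtRank = N.rank :=
  rank_traceB_vecProj N

lemma PureState.exists_matrix {a b : ℕ} (ψ : PureState a b) :
    ∃ N : Matrix (Fin b) (Fin a) ℂ, star (vec N) ⬝ᵥ vec N = 1 ∧ ψ.1.mat = vecProj N ∧
      ψ.schmidtRank = N.rank := by
  obtain ⟨v, hv, hψ⟩ := ψ.2
  obtain ⟨N, rfl⟩ := vec_bijective.surjective v
  exact ⟨N, hv, hψ, by rw [PureState.schmidtRank, hψ]; exact rank_traceB_vecProj N⟩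

/-! ### Mixtures of pure states of bounded Schmidt rank -/

/-- The cone of mixtures of pure states of Schmidt rank at most `k`. -/
def rankCone (a b k : ℕ) : AddSubmonoid (Op a b) :=
  AddSubmonoid.closure {X | ∃ (p : ℝ) (ψ : PureState a b),
    0 ≤ p ∧ ψ.schmidtRank ≤ k ∧ X = (p : ℂ) • ψ.1.mat}

lemma vecProj_mem_rankCone {a b k : ℕ} (N : Matrix (Fin b) (Fin a) ℂ) (hN : N.rank ≤ k) :
    vecProj N ∈ rankCone a b k := by
  by_cases h0 : N = 0
  · rw [h0, vecProj_zero]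
    exact zero_mem _
  have hv : vec N ≠ 0 := by simpa using h0
  have hpos : 0 < star (vec N) ⬝ᵥ vec N := dotProduct_star_self_pos_iff.2 hv
  obtain ⟨r, hr⟩ : ∃ r : ℝ, star (vec N) ⬝ᵥ vec N = r :=
    -- A complex number that is at least `0` in the complex order is real.
    ⟨_, (Complex.eq_re_of_ofReal_le (r := 0) (by simp))⟩
  have hr0 : 0 < r := by rw [hr] at hpos; exact_mod_cast hpos
  have hs : (Real.sqrt r : ℂ) * Real.sqrt r = r := by
    exact_mod_cast Real.mul_self_sqrt hr0.le
  have hs0 : (Real.sqrt r : ℂ) ≠ 0 := by exact_mod_cast (Real.sqrt_pos.2 hr0).ne'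
  have hr0' : (r : ℂ) ≠ 0 := by exact_mod_cast hr0.ne'
  set c : ℂ := (Real.sqrt r : ℂ)⁻¹ with hc
  have hcc : c * star c = (r : ℂ)⁻¹ := by
    rw [hc, ← hs]; simp
  -- The weight is the squared norm `r`; scaling by `c = 1/√r` normalises the vector.
  refine AddSubmonoid.subset_closure ⟨r, PureState.ofMatrix (c • N) ?_, hr0.le, ?_, ?_⟩
  · rw [vec_smul, star_smul, smul_dotProduct, dotProduct_smul, hr, smul_smul, mul_comm (star c),
      hcc, smul_eq_mul, inv_mul_cancel₀ hr0']
  · rw [PureState.schmidtRank_ofMatrix]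
    refine le_trans ?_ hN
    have : c • N = N * (c • (1 : Matrix (Fin a) (Fin a) ℂ)) := by simp
    rw [this]
    exact rank_mul_le_left _ _
  · change _ = (r : ℂ) • vecProj (c • N)
    rw [vecProj_smul, hcc, smul_smul, mul_inv_cancel₀ hr0', one_smul]

/-- By linearity it suffices to test generators, whose weight `p` is absorbed into the coefficient
matrix as `√p`. -/
lemma map_mem_rankCone {a b c d k : ℕ} (Φ : Op a b →ₗ[ℂ] Op c d)
    (h : ∀ N : Matrix (Fin b) (Fin a) ℂ, N.rank ≤ k → Φ (vecProj N) ∈ rankCone c d k)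
    {X : Op a b} (hX : X ∈ rankCone a b k) : Φ X ∈ rankCone c d k := by
  induction hX using AddSubmonoid.closure_induction with
  | mem X hX =>
    obtain ⟨p, ψ, hp, hψ, rfl⟩ := hX
    obtain ⟨N, -, hN, hr⟩ := ψ.exists_matrix
    have hs : (Real.sqrt p : ℂ) * star (Real.sqrt p : ℂ) = p := by
      simp only [RCLike.star_def, Complex.conj_ofReal]
      exact_mod_cast Real.mul_self_sqrt hp
    rw [hN, ← hs, ← vecProj_smul]
    refine h _ (le_trans ?_ (hr ▸ hψ))
    have : (Real.sqrt p : ℂ) • N = N * ((Real.sqrt p : ℂ) • (1 : Matrix (Fin a) (Fin a) ℂ)) := by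
      simp
    rw [this]
    exact rank_mul_le_left _ _
  | zero => rw [map_zero]; exact zero_mem _
  | add X Y _ _ hX hY => rw [map_add]; exact add_mem hX hY

lemma IsLOCC.map_mem_rankCone {a b c d k : ℕ} {Φ : Op a b →ₗ[ℂ] Op c d} (hΦ : IsLOCC Φ)
    {X : Op a b} (hX : X ∈ rankCone a b k) : Φ X ∈ rankCone c d k := by
  induction hΦ with
  | id a b => exact hX
  | alice a' K hK Φ hΦ ih =>
    rw [LinearMap.sum_apply]
    refine sum_mem fun j _ => ih j (Bipartite.map_mem_rankCone _ (fun N hN => ?_) hX)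
    rw [aliceKraus_vecProj]
    exact vecProj_mem_rankCone _ ((rank_mul_le_left _ _).trans hN)
  | bob b' M hM Φ hΦ ih =>
    rw [LinearMap.sum_apply]
    refine sum_mem fun j _ => ih j (Bipartite.map_mem_rankCone _ (fun N hN => ?_) hX)
    rw [bobKraus_vecProj]
    exact vecProj_mem_rankCone _ ((rank_mul_le_right _ _).trans hN)

lemma exists_decomposition_of_mem_rankCone {a b k : ℕ} (ρ : State a b)
    (h : ρ.mat ∈ rankCone a b k) :
    ∃ D : PureDecomposition ρ, ∀ i, (D.ψ i).schmidtRank ≤ k := by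
  have key : ∀ X ∈ rankCone a b k, ∃ (n : ℕ) (p : Fin n → ℝ) (ψ : Fin n → PureState a b),
      (∀ i, 0 ≤ p i) ∧ (∀ i, (ψ i).schmidtRank ≤ k) ∧ X = ∑ i, (p i : ℂ) • (ψ i).1.mat := by
    intro X hX
    induction hX using AddSubmonoid.closure_induction with
    | mem X hX =>
      obtain ⟨p, ψ, hp, hψ, rfl⟩ := hX
      exact ⟨1, fun _ => p, fun _ => ψ, fun _ => hp, fun _ => hψ, by simp⟩
    | zero => exact ⟨0, Fin.elim0, Fin.elim0, fun i => i.elim0, fun i => i.elim0, by simp⟩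
    | add X Y _ _ hX hY =>
      obtain ⟨n, p, ψ, hp, hψ, rfl⟩ := hX
      obtain ⟨m, q, φ, hq, hφ, rfl⟩ := hY
      refine ⟨n + m, Fin.append p q, Fin.append ψ φ, fun i => ?_, fun i => ?_, ?_⟩
      · refine Fin.addCases (fun i => ?_) (fun i => ?_) i <;> simp [hp, hq]
      · refine Fin.addCases (fun i => ?_) (fun i => ?_) i <;> simp [hψ, hφ]
      · simp [Fin.sum_univ_add]
  obtain ⟨n, p, ψ, hp, hψ, hρ⟩ := key _ h
  exact ⟨⟨n, p, hp, ψ, hρ⟩, hψ⟩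

instance {a b : ℕ} (ρ : State a b) : Nonempty (PureDecomposition ρ) := by
  obtain ⟨m, v, hv⟩ := posSemidef_iff_eq_sum_vecMulVec.1 ρ.posSemidef
  -- With `k = a` the rank bound is vacuous: coefficient matrices have `a` columns.
  refine (exists_decomposition_of_mem_rankCone (k := a) ρ ?_).nonempty
  rw [hv]
  refine sum_mem fun i _ => ?_
  obtain ⟨N, hN⟩ := vec_bijective.surjective (v i)
  rw [← hN]
  exact vecProj_mem_rankCone N (rank_le_width N)

/-! ### The Schmidt number -/

section SchmidtNumber

variable {a b : ℕ} {ρ : State a b}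

lemma PureDecomposition.sum_p (D : PureDecomposition ρ) : ∑ i, D.p i = 1 := by
  have h := congrArg trace D.sum_eq
  simp only [ρ.trace_eq_one, trace_sum, trace_smul, State.trace_eq_one, smul_eq_mul,
    mul_one] at h
  exact_mod_cast h.symm

lemma PureDecomposition.univ_nonempty (D : PureDecomposition ρ) :
    (Finset.univ : Finset (Fin D.n)).Nonempty := by
  rw [Finset.nonempty_iff_ne_empty]
  intro h
  simpa [h] using D.sum_p

lemma PureDecomposition.schmidtRank_le (D : PureDecomposition ρ) (i : Fin D.n) :
    (D.ψ i).schmidtRank ≤ D.maxSchmidtRank :=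
  Finset.le_sup (f := fun i => (D.ψ i).schmidtRank) (Finset.mem_univ i)

lemma PureDecomposition.exists_schmidtRank_eq (D : PureDecomposition ρ) :
    ∃ i, (D.ψ i).schmidtRank = D.maxSchmidtRank := by
  obtain ⟨i, -, hi⟩ := Finset.exists_mem_eq_sup _ D.univ_nonempty fun i => (D.ψ i).schmidtRank
  exact ⟨i, hi.symm⟩

lemma schmidtNumber_le (D : PureDecomposition ρ) : schmidtNumber ρ ≤ D.maxSchmidtRank :=
  Nat.sInf_le ⟨D, rfl⟩

variable (ρ) in
lemma exists_maxSchmidtRank_eq : ∃ D : PureDecomposition ρ, D.maxSchmidtRank = schmidtNumber ρ :=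
  Nat.sInf_mem (Set.range_nonempty fun D : PureDecomposition ρ => D.maxSchmidtRank)

lemma schmidtNumber_le_of_mem_rankCone {k : ℕ} (h : ρ.mat ∈ rankCone a b k) :
    schmidtNumber ρ ≤ k := by
  obtain ⟨D, hD⟩ := exists_decomposition_of_mem_rankCone ρ h
  exact (schmidtNumber_le D).trans (Finset.sup_le fun i _ => hD i)

/-- Condition (1), applied to a minimising decomposition, gives `k ≤ schmidtNumber ρ`; condition (2)
gives the reverse. -/
lemma hasSchmidtNumber_iff {k : ℕ} : HasSchmidtNumber ρ k ↔ k = schmidtNumber ρ := by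
  constructor
  · rintro ⟨h₁, D, hD⟩
    apply le_antisymm
    · obtain ⟨D', hD'⟩ := exists_maxSchmidtRank_eq ρ
      obtain ⟨i, hi⟩ := h₁ D'
      exact hD' ▸ hi.trans (D'.schmidtRank_le i)
    · exact (schmidtNumber_le D).trans (Finset.sup_le fun i _ => hD i)
  · rintro rfl
    refine ⟨fun D => ?_, ?_⟩
    · obtain ⟨i, hi⟩ := D.exists_schmidtRank_eq
      exact ⟨i, hi ▸ schmidtNumber_le D⟩
    · obtain ⟨D, hD⟩ := exists_maxSchmidtRank_eq ρ
      exact ⟨D, fun i => hD ▸ D.schmidtRank_le i⟩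

lemma schmidtNumber_le_schmidtRank {a' b' : ℕ} (ψ : PureState a' b')
    (h : LOCCConvertible ψ.1 ρ) : schmidtNumber ρ ≤ ψ.schmidtRank := by
  obtain ⟨Φ, hΦ, hρ⟩ := h
  refine schmidtNumber_le_of_mem_rankCone (hρ ▸ hΦ.map_mem_rankCone ?_)
  exact AddSubmonoid.subset_closure ⟨1, ψ, zero_le_one, le_rfl, by simp⟩

end SchmidtNumber

/-! ### Converting the maximally entangled state -/

/-- Half of a singular value decomposition: in an eigenbasis `Q` of `N * Nᴴ` the rows of `Qᴴ * N`
are orthogonal, with the eigenvalues as squared norms. Rows of eigenvalue zero vanish, so `k` rows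
suffice. -/
lemma exists_schmidt_factorization {a b k : ℕ} (N : Matrix (Fin b) (Fin a) ℂ)
    (hk : N.rank ≤ k) (hkb : k ≤ b) :
    ∃ (V : Matrix (Fin b) (Fin k) ℂ) (Z : Matrix (Fin k) (Fin a) ℂ) (l : Fin k → ℂ),
      V * Z = N ∧ Vᴴ * V = 1 ∧ Z * Zᴴ = diagonal l := by
  have hA : (N * Nᴴ).IsHermitian := isHermitian_mul_conjTranspose_self N
  set Q : Matrix (Fin b) (Fin b) ℂ := hA.eigenvectorUnitary.1 with hQ
  have hQ₁ : Qᴴ * Q = 1 := Unitary.coe_star_mul_self hA.eigenvectorUnitary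
  have hQ₂ : Q * Qᴴ = 1 := Unitary.coe_mul_star_self hA.eigenvectorUnitary
  set W := Qᴴ * N with hW
  have hQW : Q * W = N := by rw [hW, ← Matrix.mul_assoc, hQ₂, Matrix.one_mul]
  have hWW : W * Wᴴ = diagonal (fun i => (hA.eigenvalues i : ℂ)) := by
    have h := hA.conjStarAlgAut_star_eigenvectorUnitary
    rw [Unitary.conjStarAlgAut_star_apply] at h
    rw [hW, conjTranspose_mul, conjTranspose_conjTranspose, Matrix.mul_assoc,
      ← Matrix.mul_assoc N, ← Matrix.mul_assoc]
    exact h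
  have hcard : (Finset.univ.filter fun i => hA.eigenvalues i ≠ 0).card ≤ k := by
    rw [← Fintype.card_subtype, ← hA.rank_eq_card_non_zero_eigs, rank_self_mul_conjTranspose]
    exact hk
  -- Pad the nonzero eigenvalues to exactly `k` indices, which `k ≤ b` allows.
  obtain ⟨s, hs, hsk⟩ := Finset.exists_superset_card_eq hcard (by simpa using hkb)
  set f : Fin k → Fin b := ⇑(s.orderEmbOfFin hsk) with hf
  have hfi : Function.Injective f := (s.orderEmbOfFin hsk).injective
  have hrange : ∀ i, i ∉ Set.range f → ∀ j, W i j = 0 := by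
    intro i hi j
    have hi0 : hA.eigenvalues i = 0 := by
      by_contra h
      refine hi ?_
      rw [hf, Finset.range_orderEmbOfFin]
      exact hs (by simpa using h)
    have h0 : W i ⬝ᵥ star (W i) = 0 := by
      have := congrFun (congrFun hWW i) i
      rw [diagonal_apply_eq, hi0] at this
      simpa [Matrix.mul_apply, dotProduct] using this
    exact congrFun (dotProduct_self_star_eq_zero.1 h0) j
  refine ⟨Q.submatrix id f, W.submatrix f id, fun i => hA.eigenvalues (f i), ?_, ?_, ?_⟩
  · rw [← hQW]
    ext i j
    simp only [Matrix.mul_apply, submatrix_apply, id]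
    exact Fintype.sum_of_injective f hfi _ _ (fun x hx => by rw [hrange x hx, mul_zero])
      fun _ => rfl
  · have : (Q.submatrix id f)ᴴ * Q.submatrix id f = (Qᴴ * Q).submatrix f f := by
      ext i j; simp [Matrix.mul_apply]
    rw [this, hQ₁, submatrix_one _ hfi]
  · have : W.submatrix f id * (W.submatrix f id)ᴴ = (W * Wᴴ).submatrix f f := by
      ext i j; simp [Matrix.mul_apply]
    rw [this, hWW, submatrix_diagonal _ _ hfi]
    rfl

/-- The coefficient matrix of the maximally entangled state of two `k`-level systems. -/
noncomputable def maxEntangled (k : ℕ) : Matrix (Fin k) (Fin k) ℂ :=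
  ((Real.sqrt k : ℂ)⁻¹) • 1

lemma inv_sqrt_mul_star (k : ℕ) :
    ((Real.sqrt k : ℂ)⁻¹) * star ((Real.sqrt k : ℂ)⁻¹) = (k : ℂ)⁻¹ := by
  have hs : (Real.sqrt k : ℂ) * Real.sqrt k = k := by
    exact_mod_cast Real.mul_self_sqrt (Nat.cast_nonneg k)
  rw [← hs]
  simp

lemma star_vec_maxEntangled_dotProduct (k : ℕ) [NeZero k] :
    star (vec (maxEntangled k)) ⬝ᵥ vec (maxEntangled k) = 1 := by
  rw [maxEntangled, vec_smul, star_smul, smul_dotProduct, dotProduct_smul, smul_smul,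
    mul_comm (star _), inv_sqrt_mul_star, star_vec_dotProduct_vec]
  simp

/-- One measurement by Alice followed by a correction by Bob turns the maximally entangled state
into any given pure state of Schmidt rank at most `k`. -/
lemma exists_isLOCC_maxEntangled {a b k : ℕ} [NeZero k] (hkb : k ≤ b) (ψ : PureState a b)
    (hψ : ψ.schmidtRank ≤ k) :
    ∃ Φ : Op k k →ₗ[ℂ] Op a b, IsLOCC Φ ∧ Φ (vecProj (maxEntangled k)) = ψ.1.mat := by
  obtain ⟨N, hN1, hN, hr⟩ := ψ.exists_matrix
  obtain ⟨V, Z, l, hVZ, hV, hZ⟩ := exists_schmidt_factorization N (hr ▸ hψ) hkb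
  have hl : ∑ i, l i = 1 := by
    rw [← trace_diagonal, ← hZ, trace_mul_comm]
    have : Zᴴ * Z = Nᴴ * N := by
      rw [← hVZ, conjTranspose_mul, Matrix.mul_assoc, ← Matrix.mul_assoc Vᴴ, hV, Matrix.one_mul]
    rw [this, ← star_vec_dotProduct_vec, hN1]
  -- Alice's outcome `s` is a cyclic shift of the Schmidt basis. Summed over all shifts, each
  -- diagonal entry of `(K s)ᴴ * K s` becomes `∑ i, l i = 1`, so the measurement is complete.
  let e : Fin k → Fin k ≃ Fin k := fun s => Equiv.addRight s
  let K : Fin k → Matrix (Fin a) (Fin k) ℂ := fun s => (Z.submatrix (e s) id)ᵀ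
  let M : Fin k → Matrix (Fin b) (Fin k) ℂ := fun s => V.submatrix id (e s)
  have hK : ∑ s, (K s)ᴴ * K s = 1 := by
    have hKs : ∀ s, (K s)ᴴ * K s = diagonal fun i => l (i + s) := by
      intro s
      have h1 : (K s)ᴴ * K s = ((Z * Zᴴ).submatrix (e s) (e s))ᵀ := by
        ext i j
        simp [K, Matrix.mul_apply, mul_comm]
      rw [h1, hZ, submatrix_diagonal _ _ (e s).injective, diagonal_transpose]
      rfl
    ext i j
    simp only [hKs, Matrix.sum_apply, diagonal_apply, one_apply]
    split_ifs
    · rw [← hl]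
      exact Equiv.sum_comp (Equiv.addLeft i) l
    · simp
  have hM : ∀ s, (M s)ᴴ * M s = 1 := by
    intro s
    have : (M s)ᴴ * M s = (Vᴴ * V).submatrix (e s) (e s) := by
      ext i j; simp [M, Matrix.mul_apply]
    rw [this, hV, submatrix_one _ (e s).injective]
  refine ⟨_, IsLOCC.alice (fun _ => a) K hK _ fun s =>
    IsLOCC.bob (fun _ : Fin 1 => b) (fun _ => M s) (by simpa using hM s) _
      fun _ => IsLOCC.id a b, ?_⟩
  -- Bob's shift cancels Alice's, so each of the `k` outcomes leaves the same state `N`, with weight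
  -- `1/k`.
  have hMK : ∀ s, M s * (maxEntangled k * (K s)ᵀ) = ((Real.sqrt k : ℂ)⁻¹) • N := by
    intro s
    rw [maxEntangled, Matrix.smul_mul, Matrix.one_mul, Matrix.mul_smul, ← hVZ]
    congr 1
    exact submatrix_mul_equiv V Z id (e s) id
  simp only [LinearMap.sum_apply, Fin.sum_univ_one, LinearMap.comp_apply, LinearMap.id_apply,
    aliceKraus_vecProj, bobKraus_vecProj, hMK, vecProj_smul, inv_sqrt_mul_star]
  rw [Finset.sum_const, Finset.card_univ, Fintype.card_fin, hN]
  rw [← Nat.cast_smul_eq_nsmul ℂ, smul_smul, mul_inv_cancel₀ (NeZero.ne _), one_smul]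

lemma PureState.schmidtRank_pos {a b : ℕ} (ψ : PureState a b) : 0 < ψ.schmidtRank := by
  obtain ⟨N, hN1, -, hr⟩ := ψ.exists_matrix
  rw [hr, Nat.pos_iff_ne_zero]
  intro h
  have h0 : N = 0 := by
    rw [Matrix.rank, Submodule.finrank_eq_zero, LinearMap.range_eq_bot] at h
    exact toLin'.injective (h.trans (map_zero _).symm)
  simp [h0] at hN1

lemma PureState.schmidtRank_le {a b : ℕ} (ψ : PureState a b) : ψ.schmidtRank ≤ b := by
  obtain ⟨N, -, -, hr⟩ := ψ.exists_matrix
  exact hr ▸ rank_le_height N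

/-- Every state arises by LOCC from a pure state of Schmidt rank at most its Schmidt number. -/
lemma exists_pureState_loccConvertible {a b : ℕ} (ρ : State a b) :
    ∃ (k : ℕ) (φ : PureState k k), LOCCConvertible φ.1 ρ ∧ φ.schmidtRank ≤ schmidtNumber ρ := by
  obtain ⟨D, hD⟩ := exists_maxSchmidtRank_eq ρ
  obtain ⟨i₀, hi₀⟩ := D.exists_schmidtRank_eq
  rw [hD] at hi₀
  set k := schmidtNumber ρ
  have : NeZero k := ⟨hi₀ ▸ (D.ψ i₀).schmidtRank_pos.ne'⟩
  have hkb : k ≤ b := hi₀ ▸ (D.ψ i₀).schmidtRank_le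
  choose Φ hΦ hΦψ using fun i =>
    exists_isLOCC_maxEntangled hkb (D.ψ i) (hD ▸ D.schmidtRank_le i)
  have hsq : ∀ i, (Real.sqrt (D.p i) : ℂ) * star (Real.sqrt (D.p i) : ℂ) = D.p i := by
    intro i
    simp only [RCLike.star_def, Complex.conj_ofReal]
    exact_mod_cast Real.mul_self_sqrt (D.p_nonneg i)
  -- Alice's scalar Kraus operators `√(p i) • 1` draw `i` with probability `p i` without disturbing
  -- the state; the protocol `Φ i` follows.
  refine ⟨k, PureState.ofMatrix (maxEntangled k) (star_vec_maxEntangled_dotProduct k),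
    ⟨_, IsLOCC.alice (fun _ => k) (fun i => (Real.sqrt (D.p i) : ℂ) • 1) ?_ Φ hΦ, ?_⟩, ?_⟩
  · simp only [conjTranspose_smul, conjTranspose_one, Matrix.smul_mul, Matrix.mul_smul,
      Matrix.one_mul, smul_smul, hsq]
    rw [← Finset.sum_smul]
    have : ∑ i, (D.p i : ℂ) = 1 := by exact_mod_cast D.sum_p
    rw [this, one_smul]
  · simp only [PureState.ofMatrix, LinearMap.sum_apply, LinearMap.comp_apply, aliceKraus_vecProj,
      transpose_smul,
      transpose_one, Matrix.mul_smul, Matrix.mul_one, vecProj_smul, hsq, map_smul, hΦψ]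
    exact D.sum_eq
  · rw [PureState.schmidtRank_ofMatrix]
    exact rank_le_height _

end Bipartite

theorem mainTheorem8 {a b : ℕ} (ρ : Bipartite.State a b) :
    (∀ k : ℕ, Bipartite.HasSchmidtNumber ρ k ↔ k = Bipartite.schmidtNumber ρ) ∧
    Bipartite.maximalExtension Bipartite.pureSchmidtRank ρ =
      ((Bipartite.schmidtNumber ρ : ℝ) : EReal) ∧
    ∀ E : ⦃a' b' : ℕ⦄ → Bipartite.State a' b' → ℝ, Bipartite.IsEntanglementMeasure E →
      (∀ ⦃a' b' : ℕ⦄ (ψ : Bipartite.PureState a' b'), E ψ.1 = Bipartite.pureSchmidtRank ψ) →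
      E ρ ≤ (Bipartite.schmidtNumber ρ : ℝ) := by
  obtain ⟨k, φ, hφ, hk⟩ := Bipartite.exists_pureState_loccConvertible ρ
  have hk' : Bipartite.pureSchmidtRank φ ≤ (Bipartite.schmidtNumber ρ : ℝ) := Nat.cast_le.2 hk
  refine ⟨fun k => Bipartite.hasSchmidtNumber_iff, le_antisymm ?_ ?_, fun E hE hpure => ?_⟩
  · refine le_trans (sInf_le ?_) (EReal.coe_le_coe_iff.2 hk')
    exact ⟨k, k, φ, hφ, rfl⟩
  · refine le_sInf fun x hx => ?_
    obtain ⟨a', b', ψ, hψ, rfl⟩ := hx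
    exact EReal.coe_le_coe_iff.2 (Nat.cast_le.2 (Bipartite.schmidtNumber_le_schmidtRank ψ hψ))
  · exact (hE φ.1 ρ hφ).trans ((hpure φ).trans_le hk')
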